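/- **Theorem (Consistency of $\hat F_n$).** Let $\mathcal G$ be the class of upper semicontinuous probability densities $g:\mathbb R\to[0,\infty)$ (with respect to Lebesgue measure) for which there is $M>0$ such that $g$ has bounded variation on $[-M,M]$ and is monotone on $(-\infty,-M]$ and on $[M,\infty)$. For a density $f$ and a distribution function $F$ on $\mathbb R$ put $(f*dF)(y)=\int f(y-x)\,dF(x)$. Let $f_\varepsilon\in\mathcal G$, and assume that the deconvolution problem with noise density $f_\varepsilon$ is identifiable: if $F,G$ are distribution functions on $\mathbb R$ with $f_\varepsilon*dF=f_\varepsilon*dG$ almost everywhere, then $F=G$. Let $F_X$ be a distribution function on $\mathbb R$ and let $Y_1,Y_2,\dots$ be i.i.d. real random variables with density $f_Y=f_\varepsilon*dF_X$ (that is, each $Y_i$ is distributed as $X+\varepsilon$ with $X\sim F_X$ and $\varepsilon\sim f_\varepsilon$ independent). For $n\ge1$ let $\mathcal F_n$ be the (random) set of all piecewise constant distribution functions on $\mathbb R$ all of whose jumps are located at points of $\{Y_1,\dots,Y_n\}$, and for $F\in\mathcal F_n$ let $$\tilde L_n(F)=\frac1n\sum_{i=1}^n\log\big((f_\varepsilon*dF)(Y_i)\big)\in[-\infty,\infty),\qquad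 \log 0=-\infty .$$ Let $\hat F_n$ be any maximizer of $\tilde L_n$ over $\mathcal F_n$ (a maximum likelihood estimator; no uniqueness is assumed). Assume moreover that 1. the support of the distribution with distribution function $F_X$ is contained in the support of the distribution with density $f_Y$ (this holds for instance whenever $0$ belongs to the support of the distribution with density $f_\varepsilon$), and 2. almost surely, for all sufficiently large $n$, $\tilde L_n$ is not identically $-\infty$ on $\mathcal F_n$ (this holds for instance whenever $f_\varepsilon(0)>0$). Then, with probability one, $\lim_{n\to\infty}\hat F_n(x)=F_X(x)$ for every $x$ at which $F_X$ is continuous. If $F_X$ is continuous, then with probability one $$\lim_{n\to\infty}\|\hat F_n-F_X\|_\infty=\lim_{n\to\infty}\sup_{x\in\mathbb R}|\hat F_n(x)-F_X(x)|=0 .$$ -/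

import Mathlib

open MeasureTheory ProbabilityTheory Filter Topology Set

noncomputable section

namespace Deconvolution

/-- The class of noise densities: upper semicontinuous Lebesgue probability densities on `ℝ`
that are of bounded variation on some interval `[-M, M]`, `M > 0`, and monotone (in either
direction) on each of the half-lines `(-∞, -M]` and `[M, ∞)`. -/
def NoiseClass : Set (ℝ → ℝ) :=
  {g | (∀ x, 0 ≤ g x) ∧ UpperSemicontinuous g ∧ Integrable g volume ∧ ∫ x, g x = 1 ∧
    ∃ M : ℝ, 0 < M ∧ BoundedVariationOn g (Icc (-M) M) ∧
      (MonotoneOn g (Iic (-M)) ∨ AntitoneOn g (Iic (-M))) ∧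
      (MonotoneOn g (Ici M) ∨ AntitoneOn g (Ici M))}

/-- The convolution `(f * dF)(y) = ∫ f (y - x) dF(x)`. A distribution function `F` on `ℝ` is
represented by its probability measure; the function itself is `cdf F`. -/
def convDensity (f : ℝ → ℝ) (F : ProbabilityMeasure ℝ) (y : ℝ) : ℝ :=
  ∫ x, f (y - x) ∂(F : Measure ℝ)

/-- The distribution with Lebesgue density `f * dF`, that is, the law of `Y = X + ε` for
independent `X` with distribution function `F` and `ε` with density `f`. -/
def convLaw (f : ℝ → ℝ) (F : ProbabilityMeasure ℝ) : Measure ℝ :=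
  volume.withDensity fun y => ENNReal.ofReal (convDensity f F y)

/-- The deconvolution problem with noise density `f` is identifiable: two distribution functions
that give the same density `f * dF` (almost everywhere) are equal. -/
def Identifiable (f : ℝ → ℝ) : Prop :=
  ∀ F G : ProbabilityMeasure ℝ, convDensity f F =ᵐ[volume] convDensity f G → F = G

/-- The sieve of a sample `y`: the piecewise constant distribution functions whose jumps are at
observations. If `y₁ < ⋯ < yₙ` are the ordered observations, the intervals `[a, b]` with no
observation in `(a, b]` are exactly the compact subintervals of `(-∞, y₁)`, of some
`[yᵢ₋₁, yᵢ)`, or of `[yₙ, ∞)`; so `cdf F` is constant on each of these sets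
(with value `0` on the first and `1` on the last). -/
def sieve {n : ℕ} (y : Fin n → ℝ) : Set (ProbabilityMeasure ℝ) :=
  {F | ∀ a b : ℝ, a ≤ b → (∀ i, y i ∉ Ioc a b) →
    cdf (F : Measure ℝ) a = cdf (F : Measure ℝ) b}

/-- The scaled log-likelihood `(1 / n) ∑ᵢ log ((f * dF)(yᵢ))`, with values in `[-∞, ∞)`
(`log 0 = -∞`). -/
def logLikelihood (f : ℝ → ℝ) {n : ℕ} (y : Fin n → ℝ) (F : ProbabilityMeasure ℝ) : EReal :=
  (((n : ℝ)⁻¹ : ℝ) : EReal) * ∑ i, ENNReal.log (ENNReal.ofReal (convDensity f F (y i)))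

/-- `F` is a (sieved) maximum likelihood estimator for the sample `y`. -/
def IsMLE (f : ℝ → ℝ) {n : ℕ} (y : Fin n → ℝ) (F : ProbabilityMeasure ℝ) : Prop :=
  F ∈ sieve y ∧ ∀ G ∈ sieve y, logLikelihood f y G ≤ logLikelihood f y F

end Deconvolution

end

noncomputable section

namespace Deconvolution

/-! Write `f` for the noise density, `u = f * dFX`, and `H` for the law with density `u`. Moving
from the estimator towards a sieve member `G` cannot raise the likelihood, so the sample mean of `(f
* dG) / (f * dF̂ₙ)` is at most one (`IsMLE.sum_div_le`). Take for `G` the image of `FX` under the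
nearest-sample-point map. The closure of the sample contains the support of `FX`, so `f * dG → u`
almost everywhere.

On the compact extended line the estimators have subsequential weak limits; let `ν` be the real part
of one, and `v = f * dν`. Since `f` vanishes at `±∞` and has countably many discontinuities, `f *
dF̂ₙ → v` almost everywhere along the subsequence (`ae_tendsto_convDensity`). With `δ > 0` added to
the denominator, the ratios have variation bounded uniformly in `n`. A Koksma inequality and
Glivenko–Cantelli then replace the empirical measure by `H`, and `∫ u / (v + δ) dH ≤ 1` follows
(`integral_div_add_le_one`).

As `δ → 0`, `∫ u / v dH ≤ 1`, while `∫ v / u dH ≤ 1` because `v` has mass at most one; `u / v + v /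
u ≥ 2` forces `u = v` (`ae_eq_of_integral_div_le_one`). Hence `ν` has mass one, nothing escaped to
infinity, and identifiability gives `ν = FX`. All subsequential limits agree, so the sequence
converges; Pólya's theorem makes the convergence uniform when `cdf FX` is continuous. -/

/-! ### Bounded variation, expressed by a monotone majorant of increments -/

/-- The increments of `f` are dominated by those of a monotone function `m` with values in
`[0, V]`. -/
structure DominatedBy (f m : ℝ → ℝ) (V : ℝ) : Prop where
  mono : Monotone m
  nonneg : ∀ x, 0 ≤ m x
  le : ∀ x, m x ≤ V
  abs_sub_le : ∀ s t, s ≤ t → |f t - f s| ≤ m t - m s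

namespace DominatedBy

variable {f m : ℝ → ℝ} {V : ℝ}

lemma bound_nonneg (h : DominatedBy f m V) : 0 ≤ V := (h.nonneg 0).trans (h.le 0)

lemma monotone_add (h : DominatedBy f m V) : Monotone (fun x => m x + f x) := fun s t hst => by
  have := abs_le.1 (h.abs_sub_le s t hst)
  dsimp only
  linarith

lemma measurable (h : DominatedBy f m V) : Measurable f := by
  have : f = fun x => (m x + f x) - m x := by ext; ring
  rw [this]
  exact h.monotone_add.measurable.sub h.mono.measurable

lemma abs_sub_le_bound (h : DominatedBy f m V) (s t : ℝ) : |f t - f s| ≤ V := by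
  rcases le_total s t with hst | hst
  · linarith [h.abs_sub_le s t hst, h.nonneg s, h.le t]
  · rw [abs_sub_comm]
    linarith [h.abs_sub_le t s hst, h.nonneg t, h.le s]

lemma continuousAt (h : DominatedBy f m V) {x : ℝ} (hm : ContinuousAt m x) : ContinuousAt f x := by
  rw [Metric.continuousAt_iff] at hm ⊢
  intro ε hε
  obtain ⟨δ, hδ, H⟩ := hm ε hε
  refine ⟨δ, hδ, fun y hy => lt_of_le_of_lt ?_ (H hy)⟩
  rw [Real.dist_eq, Real.dist_eq]
  rcases le_total x y with hxy | hxy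
  · exact (h.abs_sub_le x y hxy).trans (le_abs_self _)
  · rw [abs_sub_comm, abs_sub_comm (m y)]
    exact (h.abs_sub_le y x hxy).trans (le_abs_self _)

lemma countable_not_continuousAt (h : DominatedBy f m V) : {x | ¬ ContinuousAt f x}.Countable :=
  h.mono.countable_not_continuousAt.mono fun _ hx hm => hx (h.continuousAt hm)

end DominatedBy

/-! ### Tails and variation of noise densities -/

/-- An integrable function cannot stay above a positive constant on a half-line. So an increasing
tail is zero, and a decreasing one tends to zero. -/
lemma integrable_tail {g : ℝ → ℝ} {M : ℝ} (h0 : ∀ x, 0 ≤ g x) (hi : Integrable g)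
    (hm : MonotoneOn g (Ici M) ∨ AntitoneOn g (Ici M)) :
    AntitoneOn g (Ici M) ∧ Tendsto g atTop (𝓝 0) := by
  have key : ∀ c > 0, ∀ a, ¬ ∀ x ∈ Ici a, c ≤ g x := by
    intro c hc a hx
    have h1 : Integrable (fun _ : ℝ => c) (volume.restrict (Ici a)) := by
      refine (hi.integrableOn (s := Ici a)).mono' (by fun_prop) ?_
      filter_upwards [ae_restrict_mem measurableSet_Ici] with x hxa
      rw [Real.norm_eq_abs, abs_of_pos hc]
      exact hx x hxa
    rw [integrable_const_iff] at h1
    rcases h1 with h1 | h1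
    · exact hc.ne' h1
    · rw [isFiniteMeasure_restrict] at h1
      exact h1 (by simp)
  have hanti : AntitoneOn g (Ici M) := by
    rcases hm with hm | hm
    · have hz : ∀ x ∈ Ici M, g x = 0 := by
        intro x hx
        by_contra hne
        refine key (g x) (lt_of_le_of_ne (h0 x) (Ne.symm hne)) x fun y hy => ?_
        exact hm hx (le_trans (show M ≤ x from hx) hy) hy
      intro x hx y hy _
      rw [hz x hx, hz y hy]
    · exact hm
  refine ⟨hanti, ?_⟩
  rw [Metric.tendsto_atTop]
  intro ε hε
  have := key ε hε M
  push Not at this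
  obtain ⟨x, hx, hxε⟩ := this
  refine ⟨x, fun y hy => ?_⟩
  rw [Real.dist_eq, sub_zero, abs_of_nonneg (h0 y)]
  exact (hanti hx (le_trans (show M ≤ x from hx) hy) hy).trans_lt hxε

lemma NoiseClass.tendsto_atTop {f : ℝ → ℝ} (hf : f ∈ NoiseClass) : Tendsto f atTop (𝓝 0) := by
  obtain ⟨h0, -, hi, -, M, -, -, -, h2⟩ := hf
  exact (integrable_tail h0 hi h2).2

lemma NoiseClass.monotoneOn_lower_tail {f : ℝ → ℝ} {M : ℝ} (h0 : ∀ x, 0 ≤ f x) (hi : Integrable f)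
    (hm : MonotoneOn f (Iic (-M)) ∨ AntitoneOn f (Iic (-M))) :
    MonotoneOn f (Iic (-M)) ∧ Tendsto f atBot (𝓝 0) := by
  have h := integrable_tail (g := fun x => f (-x)) (M := M) (fun x => h0 _) hi.comp_neg (by
    rcases hm with hm | hm
    · exact Or.inr fun x hx y hy hxy => hm (mem_Iic.2 (neg_le_neg hy)) (mem_Iic.2 (neg_le_neg hx)) (neg_le_neg hxy)
    · exact Or.inl fun x hx y hy hxy => hm (mem_Iic.2 (neg_le_neg hy)) (mem_Iic.2 (neg_le_neg hx)) (neg_le_neg hxy))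
  refine ⟨fun x hx y hy hxy => ?_, ?_⟩
  · have hx' : -x ∈ Ici M := by simpa using le_neg_of_le_neg (show x ≤ -M from hx)
    have hy' : -y ∈ Ici M := by simpa using le_neg_of_le_neg (show y ≤ -M from hy)
    simpa using h.1 hy' hx' (neg_le_neg hxy)
  · simpa [Function.comp_def] using h.2.comp tendsto_neg_atBot_atTop

lemma NoiseClass.tendsto_atBot {f : ℝ → ℝ} (hf : f ∈ NoiseClass) : Tendsto f atBot (𝓝 0) := by
  obtain ⟨h0, -, hi, -, M, -, -, h1, -⟩ := hf
  exact (NoiseClass.monotoneOn_lower_tail h0 hi h1).2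

lemma NoiseClass.exists_dominatedBy {f : ℝ → ℝ} (hf : f ∈ NoiseClass) :
    ∃ m V, DominatedBy f m V := by
  obtain ⟨h0, -, hi, -, M, hM, hbv, h1, h2⟩ := hf
  have hup := (integrable_tail h0 hi h2).1
  have hlow := (NoiseClass.monotoneOn_lower_tail h0 hi h1).1
  have hloc := hbv.locallyBoundedVariationOn
  set v := variationOnFromTo f (Icc (-M) M) (-M)
  set c : ℝ → ℝ := fun x => max (-M) (min x M)
  have hMM : -M ≤ M := by linarith
  have hc : ∀ x, c x ∈ Icc (-M) M := fun x => ⟨le_max_left _ _, max_le hMM (min_le_right _ _)⟩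
  have hcm : Monotone c := fun x y hxy => max_le_max le_rfl (min_le_min hxy le_rfl)
  -- Left tail, clamped middle and right tail: of the three varying terms, the first is increasing,
  -- the second has bounded variation, the third is decreasing.
  have hdec : ∀ x, f x = f (min x (-M)) + f (c x) + f (max x M) - f (-M) - f M := by
    intro x
    rcases le_total x (-M) with hx | hx
    · have e1 : c x = -M := max_eq_left ((min_le_left _ _).trans hx)
      rw [min_eq_left hx, max_eq_right (hx.trans hMM), e1]; ring
    · rcases le_total x M with hx' | hx'
      · have e1 : c x = x := by simp only [c]; rw [min_eq_left hx', max_eq_right hx]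
        rw [min_eq_right hx, max_eq_right hx', e1]; ring
      · have e1 : c x = M := by simp only [c]; rw [min_eq_right hx', max_eq_right hMM]
        rw [min_eq_right hx, max_eq_left hx', e1]; ring
  refine ⟨fun x => f (min x (-M)) + v (c x) + (f M - f (max x M)),
    f (-M) + (eVariationOn f (Icc (-M) M)).toReal + f M, ?_⟩
  have hI : ∀ s t, s ≤ t → f (min s (-M)) ≤ f (min t (-M)) := fun s t hst =>
    hlow (mem_Iic.2 (min_le_right _ _)) (mem_Iic.2 (min_le_right _ _)) (min_le_min hst le_rfl)
  have hA : ∀ s t, s ≤ t → f (max t M) ≤ f (max s M) := fun s t hst =>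
    hup (mem_Ici.2 (le_max_right _ _)) (mem_Ici.2 (le_max_right _ _)) (max_le_max hst le_rfl)
  have hv : ∀ s t, s ≤ t → |f (c t) - f (c s)| ≤ v (c t) - v (c s) := fun s t hst =>
    variationOnFromTo.abs_sub_le_sub_of_le hloc (left_mem_Icc.2 hMM) (hc s) (hc t) (hcm hst)
  refine ⟨fun s t hst => ?_, fun x => ?_, fun x => ?_, fun s t hst => ?_⟩
  · have := (abs_nonneg _).trans (hv s t hst)
    have := hI s t hst
    have := hA s t hst
    linarith
  · have : 0 ≤ v (c x) := variationOnFromTo.nonneg_of_le _ _ (hc x).1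
    have : f (max x M) ≤ f M := hup self_mem_Ici (mem_Ici.2 (le_max_right _ _)) (le_max_right _ _)
    have := h0 (min x (-M))
    linarith
  · have : v (c x) ≤ _ := (le_abs_self _).trans (variationOnFromTo.abs_le_eVariationOn hbv)
    have : f (min x (-M)) ≤ f (-M) :=
      hlow (mem_Iic.2 (min_le_right _ _)) (show -M ≤ -M from le_rfl) (min_le_right _ _)
    have := h0 (max x M)
    linarith
  · rw [hdec t, hdec s]
    have h3 := abs_le.1 (hv s t hst)
    have := hI s t hst
    have := hA s t hst
    rw [abs_le]
    constructor <;> linarith [h3.1, h3.2]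

/-! ### Koksma's inequality, Pólya's theorem and weak convergence -/

/-- Layer-cake formula: the superlevel sets of a monotone function are complements of lower sets,
and only levels in `(0, V]` contribute. -/
lemma abs_integral_sub_le_of_monotone {μ ν : Measure ℝ} [IsProbabilityMeasure μ]
    [IsProbabilityMeasure ν] {p : ℝ → ℝ} {V η : ℝ} (hp : Monotone p) (h0 : ∀ x, 0 ≤ p x)
    (hV : ∀ x, p x ≤ V) (h : ∀ S : Set ℝ, IsLowerSet S → |μ.real S - ν.real S| ≤ η) :
    |∫ x, p x ∂μ - ∫ x, p x ∂ν| ≤ V * η := by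
  have hup : ∀ t, IsUpperSet {x | t ≤ p x} := fun t x y hxy hx => le_trans hx (hp hxy)
  have hmeas : ∀ t, MeasurableSet {x | t ≤ p x} := fun t => hp.measurable measurableSet_Ici
  have hdiff : ∀ t, |μ.real {x | t ≤ p x} - ν.real {x | t ≤ p x}| ≤ η := by
    intro t
    have := h _ (hup t).compl
    rw [probReal_compl_eq_one_sub (hmeas t), probReal_compl_eq_one_sub (hmeas t)] at this
    rw [abs_sub_comm]
    convert this using 2
    ring
  have hint : ∀ (ρ : Measure ℝ) [IsProbabilityMeasure ρ],
      IntegrableOn (fun t => ρ.real {x | t ≤ p x}) (Ioc 0 V) := by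
    intro ρ _
    refine Measure.integrableOn_of_bounded (M := 1) (by simp) ?_ ?_
    · refine (Antitone.measurable fun s t hst => ?_).aestronglyMeasurable
      exact measureReal_mono fun x hx => le_trans hst hx
    · exact Eventually.of_forall fun t => by
        rw [Real.norm_eq_abs, abs_of_nonneg measureReal_nonneg]
        exact measureReal_le_one
  have hlayer : ∀ (ρ : Measure ℝ) [IsProbabilityMeasure ρ],
      ∫ x, p x ∂ρ = ∫ t in Ioc 0 V, ρ.real {x | t ≤ p x} := by
    intro ρ _
    refine Integrable.integral_eq_integral_Ioc_meas_le ?_ (Eventually.of_forall h0)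
      (Eventually.of_forall hV)
    refine Integrable.of_bound hp.measurable.aestronglyMeasurable V (Eventually.of_forall fun x => ?_)
    rw [Real.norm_eq_abs, abs_of_nonneg (h0 x)]
    exact hV x
  rw [hlayer μ, hlayer ν, ← integral_sub (hint μ) (hint ν), ← Real.norm_eq_abs]
  refine (norm_setIntegral_le_of_norm_le_const (C := η) (by simp) fun t _ => ?_).trans ?_
  · rw [Real.norm_eq_abs]
    exact hdiff t
  · rw [Measure.real, Real.volume_Ioc, ENNReal.toReal_ofReal (by linarith [h0 0, hV 0])]
    linarith

/-- A Koksma-type inequality. -/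
lemma DominatedBy.abs_integral_sub_le {μ ν : Measure ℝ} [IsProbabilityMeasure μ]
    [IsProbabilityMeasure ν] {f m : ℝ → ℝ} {V B η : ℝ} (hf : DominatedBy f m V)
    (h0 : ∀ x, 0 ≤ f x) (hB : ∀ x, f x ≤ B)
    (h : ∀ S : Set ℝ, IsLowerSet S → |μ.real S - ν.real S| ≤ η) :
    |∫ x, f x ∂μ - ∫ x, f x ∂ν| ≤ (2 * V + B) * η := by
  -- `f = (m + f) - m` is a difference of monotone functions bounded by `V + B` and `V`, whence the
  -- constant `2 * V + B`.
  have h1 := abs_integral_sub_le_of_monotone hf.mono hf.nonneg hf.le h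
  have h2 := abs_integral_sub_le_of_monotone hf.monotone_add
    (fun x => add_nonneg (hf.nonneg x) (h0 x)) (fun x => add_le_add (hf.le x) (hB x)) h
  have hsplit : ∀ (ρ : Measure ℝ) [IsProbabilityMeasure ρ],
      ∫ x, (m x + f x) ∂ρ = ∫ x, m x ∂ρ + ∫ x, f x ∂ρ := by
    intro ρ _
    refine integral_add ?_ ?_
    · refine Integrable.of_bound hf.mono.measurable.aestronglyMeasurable V
        (Eventually.of_forall fun x => ?_)
      rw [Real.norm_eq_abs, abs_of_nonneg (hf.nonneg x)]
      exact hf.le x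
    · refine Integrable.of_bound hf.measurable.aestronglyMeasurable B
        (Eventually.of_forall fun x => ?_)
      rw [Real.norm_eq_abs, abs_of_nonneg (h0 x)]
      exact hB x
  rw [hsplit μ, hsplit ν] at h2
  rw [abs_le] at h1 h2 ⊢
  constructor <;> linarith [h1.1, h1.2, h2.1, h2.2]

/-- Lower sets are totally ordered by inclusion, so `S` can be compared with the half-lines at
neighbouring quantiles; at the extreme levels the bounds `0` and `1` serve instead. -/
lemma abs_sub_le_of_quantiles {μ ν : Measure ℝ} [IsProbabilityMeasure μ] [IsProbabilityMeasure ν]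
    {K : ℕ} (hK : 0 < K) (x : ℕ → ℝ)
    (hν : ∀ j, 0 < j → j < K → ν.real (Iic (x j)) = j / K)
    (hμ : ∀ j, 0 < j → j < K → |μ.real (Iic (x j)) - j / K| ≤ 1 / K)
    {S : Set ℝ} (hS : IsLowerSet S) : |μ.real S - ν.real S| ≤ 3 / K := by
  have hK' : (0 : ℝ) < K := by exact_mod_cast hK
  have hin : ∀ z, z ∈ S → Iic z ⊆ S := fun z hz w hw => hS hw hz
  have hout : ∀ z, z ∉ S → S ⊆ Iic z := fun z hz w hw => by
    by_contra hzw
    exact hz (hS (le_of_not_ge hzw) hw)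
  have h0 : 0 ≤ ν.real S := measureReal_nonneg
  have h1 : ν.real S ≤ 1 := measureReal_le_one
  have h3 : (3 : ℝ) / K = 1 / K + 1 / K + 1 / K := by ring
  have hpos : (0 : ℝ) < 1 / K := by positivity
  rw [abs_le]
  constructor
  · -- lower bound
    -- In the first case `j / K < ν S ≤ (j + 1) / K`; the strict inequality puts `x j` in `S`.
    obtain ⟨j, hj⟩ : ∃ j : ℕ, j + 1 = ⌈ν.real S * K⌉₊ ∨ ⌈ν.real S * K⌉₊ = 0 := by
      rcases Nat.eq_zero_or_pos ⌈ν.real S * K⌉₊ with h | h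
      · exact ⟨0, Or.inr h⟩
      · exact ⟨⌈ν.real S * K⌉₊ - 1, Or.inl (by omega)⟩
    have hle := Nat.le_ceil (ν.real S * K)
    have hμ0 : 0 ≤ μ.real S := measureReal_nonneg
    rcases hj with hj | hj
    · rw [← hj] at hle
      push_cast at hle
      have hle' : ν.real S ≤ j / K + 1 / K := by
        rw [← add_div, le_div_iff₀ hK']; exact hle
      have hlt : (j : ℝ) < ν.real S * K := Nat.lt_ceil.1 (by omega)
      have hlt' : (j : ℝ) / K < ν.real S := by rwa [div_lt_iff₀ hK']
      rcases Nat.eq_zero_or_pos j with h | h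
      · subst h
        simp only [Nat.cast_zero, zero_div] at hle'
        linarith
      · have hjK : j < K := by
          have : (j : ℝ) < K := hlt.trans_le (by nlinarith)
          exact_mod_cast this
        have hxS : x j ∈ S := by
          by_contra hx
          have : ν.real S ≤ ν.real (Iic (x j)) := measureReal_mono (hout _ hx)
          rw [hν j h hjK] at this
          linarith
        have : μ.real (Iic (x j)) ≤ μ.real S := measureReal_mono (hin _ hxS)
        have := (abs_le.1 (hμ j h hjK)).1
        linarith
    · rw [hj] at hle
      simp only [Nat.cast_zero] at hle
      have : ν.real S ≤ 0 := by
        by_contra hne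
        push Not at hne
        have := mul_pos hne hK'
        linarith
      linarith
  · -- upper bound
    have hμ1 : μ.real S ≤ 1 := measureReal_le_one
    have hfl := Nat.floor_le (mul_nonneg h0 hK'.le)
    have hlt := Nat.lt_floor_add_one (ν.real S * K)
    set j := ⌊ν.real S * K⌋₊
    have hfl' : (j : ℝ) / K ≤ ν.real S := by rwa [div_le_iff₀ hK']
    have hcast : (((j + 1 : ℕ) : ℝ)) / K = j / K + 1 / K := by push_cast; ring
    rcases lt_or_ge (j + 1) K with h | h
    · have hxS : x (j + 1) ∉ S := by
        intro hx
        have : ν.real (Iic (x (j + 1))) ≤ ν.real S := measureReal_mono (hin _ hx)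
        rw [hν _ j.succ_pos h, div_le_iff₀ hK'] at this
        push_cast at this
        linarith
      have : μ.real S ≤ μ.real (Iic (x (j + 1))) := measureReal_mono (hout _ hxS)
      have := (abs_le.1 (hμ _ j.succ_pos h)).2
      linarith
    · have : (1 : ℝ) ≤ ((j + 1 : ℕ) : ℝ) / K := by
        rw [one_le_div hK']
        exact_mod_cast h
      linarith

/-- Pólya's theorem: convergence at the quantiles of rational order implies uniform
convergence over all lower sets. -/
lemma eventually_abs_sub_le_of_quantiles {ι : Type*} {l : Filter ι} {μ : ι → Measure ℝ}
    {ν : Measure ℝ} [IsProbabilityMeasure ν] (hμ : ∀ᶠ i in l, IsProbabilityMeasure (μ i))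
    (h : ∀ q : ℚ, 0 < (q : ℝ) → (q : ℝ) < 1 → ∃ x, ν.real (Iic x) = q ∧
      Tendsto (fun i => (μ i).real (Iic x)) l (𝓝 q)) {η : ℝ} (hη : 0 < η) :
    ∀ᶠ i in l, ∀ S : Set ℝ, IsLowerSet S → |(μ i).real S - ν.real S| ≤ η := by
  obtain ⟨k, hk⟩ := exists_nat_gt (3 / η)
  have hk0 : (0 : ℝ) < k := lt_trans (by positivity) hk
  have hk' : 0 < k := by exact_mod_cast hk0
  have hq : ∀ j : ℕ, ∃ x, 0 < j → j < k → ν.real (Iic x) = j / k ∧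
      Tendsto (fun i => (μ i).real (Iic x)) l (𝓝 (j / k)) := by
    intro j
    by_cases hj : 0 < j ∧ j < k
    · obtain ⟨x, hx⟩ := h ((j : ℚ) / k)
        (by push_cast; exact div_pos (by exact_mod_cast hj.1) hk0)
        (by push_cast; rw [div_lt_one hk0]; exact_mod_cast hj.2)
      push_cast at hx
      exact ⟨x, fun _ _ => hx⟩
    · exact ⟨0, fun h1 h2 => (hj ⟨h1, h2⟩).elim⟩
  choose x hx using hq
  have hev : ∀ᶠ i in l, ∀ j ∈ Finset.range k, 0 < j → |(μ i).real (Iic (x j)) - j / k| ≤ 1 / k := by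
    rw [Finset.eventually_all]
    intro j hj
    rw [Finset.mem_range] at hj
    by_cases h0 : 0 < j
    · have := (hx j h0 hj).2
      rw [Metric.tendsto_nhds] at this
      filter_upwards [this (1 / k) (by positivity)] with i hi _
      exact (Real.dist_eq _ _ ▸ hi).le
    · exact Eventually.of_forall fun _ h => (h0 h).elim
  filter_upwards [hμ, hev] with i hi hj S hS
  refine (abs_sub_le_of_quantiles hk' x (fun j h1 h2 => (hx j h1 h2).1)
    (fun j h1 h2 => hj j (Finset.mem_range.2 h2) h1) hS).trans ?_
  rw [div_lt_iff₀ hη] at hk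
  rw [div_le_iff₀ hk0]
  linarith

lemma exists_measureReal_Iic_eq {ν : Measure ℝ} [IsProbabilityMeasure ν]
    (hν : Continuous (cdf ν)) {r : ℝ} (h0 : 0 < r) (h1 : r < 1) : ∃ x, ν.real (Iic x) = r := by
  have hb := (tendsto_cdf_atBot ν).eventually_lt_const h0
  have ht := (tendsto_cdf_atTop ν).eventually_const_lt h1
  obtain ⟨a, ha⟩ := hb.exists
  obtain ⟨b, hb⟩ := ht.exists
  obtain ⟨x, hx⟩ := mem_range_of_exists_le_of_exists_ge hν ⟨a, ha.le⟩ ⟨b, hb.le⟩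
  exact ⟨x, by rw [← cdf_eq_real, hx]⟩

lemma continuousAt_cdf_iff (ν : Measure ℝ) [IsProbabilityMeasure ν] (x : ℝ) :
    ContinuousAt (cdf ν) x ↔ ν {x} = 0 := by
  rw [(cdf ν).mono.continuousAt_iff_leftLim_eq_rightLim, StieltjesFunction.rightLim_eq]
  conv_rhs => rw [← measure_cdf ν, StieltjesFunction.measure_singleton, ENNReal.ofReal_eq_zero]
  constructor
  · intro h
    rw [h, sub_self]
  · intro h
    exact le_antisymm ((cdf ν).mono.leftLim_le le_rfl) (by linarith)

/-- Weak convergence gives convergence of the integrals of bounded functions whose set of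
discontinuities is null for the limit. -/
lemma tendsto_integral_of_ae_continuousAt {X : Type*} [TopologicalSpace X] [MeasurableSpace X]
    [OpensMeasurableSpace X] [HasOuterApproxClosed X] {μs : ℕ → ProbabilityMeasure X}
    {μ : ProbabilityMeasure X} (h : Tendsto μs atTop (𝓝 μ)) {φ : X → ℝ} {C : ℝ}
    (hφ : Measurable φ) (h0 : ∀ x, 0 ≤ φ x) (hC : ∀ x, φ x ≤ C)
    (hc : ∀ᵐ x ∂(μ : Measure X), ContinuousAt φ x) :
    Tendsto (fun n => ∫ x, φ x ∂(μs n : Measure X)) atTop (𝓝 (∫ x, φ x ∂(μ : Measure X))) := by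
  have hlayer : ∀ ρ : ProbabilityMeasure X,
      ∫ x, φ x ∂(ρ : Measure X) = ∫ t in Ioc 0 C, (ρ : Measure X).real {x | t ≤ φ x} := by
    intro ρ
    refine Integrable.integral_eq_integral_Ioc_meas_le ?_ (Eventually.of_forall h0)
      (Eventually.of_forall hC)
    refine Integrable.of_bound hφ.aestronglyMeasurable C (Eventually.of_forall fun x => ?_)
    rw [Real.norm_eq_abs, abs_of_nonneg (h0 x)]
    exact hC x
  simp_rw [hlayer]
  refine tendsto_integral_of_dominated_convergence (fun _ => 1) (fun n => ?_) (by simp)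
    (fun n => Eventually.of_forall fun t => ?_) ?_
  · refine (Antitone.measurable fun s t hst => ?_).aestronglyMeasurable
    exact measureReal_mono fun x hx => le_trans hst hx
  · rw [Real.norm_eq_abs, abs_of_nonneg measureReal_nonneg]
    exact measureReal_le_one
  -- The frontier of a superlevel set consists of discontinuities and points of the level set, and
  -- all but countably many level sets are null.
  · have hcount := Measure.countable_meas_level_set_pos (μ := (μ : Measure X)) hφ
    have : ∀ᵐ t ∂(volume : Measure ℝ), ¬ 0 < (μ : Measure X) {x | φ x = t} :=
      (measure_eq_zero_iff_ae_notMem).1 (hcount.measure_zero volume)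
    filter_upwards [ae_restrict_of_ae this] with t ht
    have hnull : (μ : Measure X) {x | φ x = t} = 0 := by simpa using ht
    have hfr : (μ : Measure X) (frontier {x | t ≤ φ x}) = 0 := by
      refine measure_mono_null (t := {x | ¬ ContinuousAt φ x} ∪ {x | φ x = t}) ?_
        (measure_union_null (ae_iff.1 hc) hnull)
      intro x hx
      by_contra hne
      simp only [mem_union, mem_ofPred_eq, not_or, not_not] at hne
      obtain ⟨hcx, hxt⟩ := hne
      rcases lt_or_gt_of_ne hxt with hlt | hgt
      · have : {x | t ≤ φ x}ᶜ ∈ 𝓝 x := by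
          filter_upwards [hcx.eventually_lt_const hlt] with z hz
          simpa using hz
        rw [← frontier_compl] at hx
        exact hx.2 (mem_interior_iff_mem_nhds.2 this)
      · refine hx.2 (mem_interior_iff_mem_nhds.2 ?_)
        filter_upwards [hcx.eventually_const_lt hgt] with z hz
        exact hz.le
    have := ProbabilityMeasure.tendsto_measure_of_null_frontier_of_tendsto' h hfr
    exact (ENNReal.tendsto_toReal (measure_ne_top _ _)).comp this

/-! ### Convolution with a function of bounded variation -/

section Convolution

variable {f m : ℝ → ℝ} {V B : ℝ}

lemma integrable_comp_sub (hf : Measurable f) (h0 : ∀ x, 0 ≤ f x) (hB : ∀ x, f x ≤ B)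
    (μ : Measure ℝ) [IsFiniteMeasure μ] (y : ℝ) : Integrable (fun x => f (y - x)) μ := by
  refine Integrable.of_bound (hf.comp (measurable_const.sub measurable_id)).aestronglyMeasurable B
    (Eventually.of_forall fun x => ?_)
  rw [Real.norm_eq_abs, abs_of_nonneg (h0 _)]
  exact hB _

lemma convDensity_nonneg (h0 : ∀ x, 0 ≤ f x) (F : ProbabilityMeasure ℝ) (y : ℝ) :
    0 ≤ convDensity f F y :=
  integral_nonneg fun _ => h0 _

lemma convDensity_le (hf : Measurable f) (h0 : ∀ x, 0 ≤ f x) (hB : ∀ x, f x ≤ B)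
    (F : ProbabilityMeasure ℝ) (y : ℝ) : convDensity f F y ≤ B := by
  refine (integral_mono (integrable_comp_sub hf h0 hB _ y) (integrable_const B)
    fun x => hB _).trans ?_
  simp

/-- Increments are averaged over translates, so the bound `V` does not depend on `F`; this
uniformity is what makes Koksma's inequality applicable to the varying estimators. -/
lemma DominatedBy.convDensity (hf : DominatedBy f m V) (h0 : ∀ x, 0 ≤ f x) (hB : ∀ x, f x ≤ B)
    (F : ProbabilityMeasure ℝ) :
    DominatedBy (convDensity f F) (Deconvolution.convDensity m F) V := by
  have hi := integrable_comp_sub hf.measurable h0 hB (F : Measure ℝ)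
  have hm := integrable_comp_sub hf.mono.measurable hf.nonneg hf.le (F : Measure ℝ)
  have key : ∀ s t, s ≤ t → |Deconvolution.convDensity f F t - Deconvolution.convDensity f F s| ≤
      Deconvolution.convDensity m F t - Deconvolution.convDensity m F s := by
    intro s t hst
    unfold Deconvolution.convDensity
    rw [← integral_sub (hi t) (hi s), ← integral_sub (hm t) (hm s)]
    refine abs_integral_le_integral_abs.trans ?_
    exact integral_mono ((hi t).sub (hi s)).abs ((hm t).sub (hm s)) fun x =>
      hf.abs_sub_le _ _ (by linarith)
  refine ⟨fun s t hst => ?_, convDensity_nonneg hf.nonneg F,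
    convDensity_le hf.mono.measurable hf.nonneg hf.le F, key⟩
  linarith [(abs_nonneg _).trans (key s t hst)]

/-- A quotient `u / (v + δ)` of dominated functions is dominated. -/
lemma DominatedBy.div_add {u v mu mv : ℝ → ℝ} {V W B δ : ℝ} (hu : DominatedBy u mu V)
    (hv : DominatedBy v mv W) (hu0 : ∀ x, 0 ≤ u x) (huB : ∀ x, u x ≤ B) (hv0 : ∀ x, 0 ≤ v x)
    (hδ : 0 < δ) :
    DominatedBy (fun x => u x / (v x + δ)) (fun x => mu x / δ + B / δ ^ 2 * mv x)
      (V / δ + B / δ ^ 2 * W) := by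
  have hB : 0 ≤ B := (hu0 0).trans (huB 0)
  have hBδ : 0 ≤ B / δ ^ 2 := by positivity
  refine ⟨fun s t hst => ?_, fun x => ?_, fun x => ?_, fun s t hst => ?_⟩
  · have h1 := hu.mono hst
    have h2 := hv.mono hst
    gcongr
  · have := hu.nonneg x
    have := hv.nonneg x
    positivity
  · have h1 := hu.le x
    have h2 := hv.le x
    gcongr
  · have hs : 0 < v s + δ := by linarith [hv0 s]
    have ht : 0 < v t + δ := by linarith [hv0 t]
    have e : u t / (v t + δ) - u s / (v s + δ) =
        (u t - u s) / (v t + δ) + u s * (v s - v t) / ((v t + δ) * (v s + δ)) := by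
      field_simp
      ring
    have h1 : |(u t - u s) / (v t + δ)| ≤ (mu t - mu s) / δ := by
      rw [abs_div, abs_of_pos ht]
      exact div_le_div₀ (by linarith [hu.mono hst]) (hu.abs_sub_le s t hst) hδ (by linarith [hv0 t])
    have h2 : |u s * (v s - v t) / ((v t + δ) * (v s + δ))| ≤ B * (mv t - mv s) / δ ^ 2 := by
      rw [abs_div, abs_of_pos (mul_pos ht hs), abs_mul, abs_of_nonneg (hu0 s), abs_sub_comm]
      refine div_le_div₀ (mul_nonneg hB (by linarith [hv.mono hst]))
        (mul_le_mul (huB s) (hv.abs_sub_le s t hst) (abs_nonneg _) hB) (by positivity) ?_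
      rw [sq]
      exact mul_le_mul (by linarith [hv0 t]) (by linarith [hv0 s]) hδ.le ht.le
    rw [e]
    refine (abs_add_le _ _).trans ((add_le_add h1 h2).trans (le_of_eq ?_))
    field_simp
    ring

/-- By Fubini: for fixed `x` only countably many `y` are bad. -/
lemma ae_ae_continuousAt_sub (hf : DominatedBy f m V) (μ : Measure ℝ) [SFinite μ] :
    ∀ᵐ y, ∀ᵐ x ∂μ, ContinuousAt f (y - x) := by
  have hc := hf.countable_not_continuousAt
  rw [← Measure.ae_ae_comm]
  · refine Eventually.of_forall fun x => ?_
    rw [ae_iff]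
    have : {y | ¬ ContinuousAt f (y - x)} = (fun y => y - x) ⁻¹' {z | ¬ ContinuousAt f z} := rfl
    rw [this]
    exact (hc.preimage sub_left_injective).measure_zero _
  · have : MeasurableSet {z | ContinuousAt f z} := by
      have h := hc.measurableSet.compl
      convert h using 1
      ext; simp
    exact (measurable_snd.sub measurable_fst) this

lemma lintegral_ofReal_integral_comp_sub (hf : Measurable f) (h0 : ∀ x, 0 ≤ f x)
    (hB : ∀ x, f x ≤ B) (hi : Integrable f) (h1 : ∫ x, f x = 1) (μ : Measure ℝ)
    [IsFiniteMeasure μ] :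
    ∫⁻ y, ENNReal.ofReal (∫ x, f (y - x) ∂μ) = μ univ := by
  have e : ∀ y, ENNReal.ofReal (∫ x, f (y - x) ∂μ) = ∫⁻ x, ENNReal.ofReal (f (y - x)) ∂μ :=
    fun y => ofReal_integral_eq_lintegral_ofReal (integrable_comp_sub hf h0 hB μ y)
      (Eventually.of_forall fun x => h0 _)
  simp_rw [e]
  rw [lintegral_lintegral_swap
    (by exact (hf.comp (measurable_fst.sub measurable_snd)).ennreal_ofReal.aemeasurable)]
  have e2 : ∀ x : ℝ, ∫⁻ y, ENNReal.ofReal (f (y - x)) = 1 := by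
    intro x
    rw [lintegral_sub_right_eq_self (fun y => ENNReal.ofReal (f y)) x,
      ← ofReal_integral_eq_lintegral_ofReal hi (Eventually.of_forall h0), h1, ENNReal.ofReal_one]
  simp [e2]

lemma measurable_integral_comp_sub (hf : Measurable f) (μ : Measure ℝ) [SFinite μ] :
    Measurable (fun y => ∫ x, f (y - x) ∂μ) := by
  have : StronglyMeasurable (Function.uncurry fun y x : ℝ => f (y - x)) :=
    (hf.comp (measurable_fst.sub measurable_snd)).stronglyMeasurable
  exact this.integral_prod_right.measurable

end Convolution

/-! ### The sieve and the likelihood inequality -/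

section Sieve

variable {n : ℕ} {y : Fin n → ℝ}

/-- In terms of null sets, membership is visibly stable under mixtures and easy to check for
push-forwards. -/
lemma mem_sieve_iff {F : ProbabilityMeasure ℝ} :
    F ∈ sieve y ↔ ∀ a b : ℝ, a ≤ b → (∀ i, y i ∉ Ioc a b) → (F : Measure ℝ) (Ioc a b) = 0 := by
  refine forall_congr' fun a => forall_congr' fun b => imp_congr_right fun hab =>
    imp_congr_right fun _ => ?_
  conv_rhs => rw [← measure_cdf (F : Measure ℝ), StieltjesFunction.measure_Ioc,
    ENNReal.ofReal_eq_zero, sub_nonpos]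
  exact ⟨fun h => h.ge, fun h => le_antisymm ((cdf _).mono hab) h⟩

lemma map_mem_sieve (F : ProbabilityMeasure ℝ) {T : ℝ → ℝ} (hT : Measurable T)
    (h : ∀ x, ∃ i, y i = T x) : F.map hT.aemeasurable ∈ sieve y := by
  rw [mem_sieve_iff]
  intro a b _ hy
  rw [ProbabilityMeasure.toMeasure_map, Measure.map_apply hT measurableSet_Ioc]
  convert measure_empty (μ := (F : Measure ℝ))
  ext x
  obtain ⟨i, hi⟩ := h x
  simp only [mem_preimage, ← hi, mem_empty_iff_false, iff_false]
  exact hy i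

/-- The mixture `(1 - t) F + t G`. -/
def mixture (F G : ProbabilityMeasure ℝ) (t : ℝ) (h0 : 0 ≤ t) (h1 : t ≤ 1) :
    ProbabilityMeasure ℝ :=
  ⟨ENNReal.ofReal (1 - t) • (F : Measure ℝ) + ENNReal.ofReal t • (G : Measure ℝ), ⟨by
    simp only [Measure.coe_add, Measure.coe_smul, Pi.add_apply, Pi.smul_apply, measure_univ,
      smul_eq_mul, mul_one]
    rw [← ENNReal.ofReal_add (by linarith) h0]
    simp⟩⟩

lemma mixture_mem_sieve {F G : ProbabilityMeasure ℝ} (hF : F ∈ sieve y) (hG : G ∈ sieve y)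
    {t : ℝ} (h0 : 0 ≤ t) (h1 : t ≤ 1) : mixture F G t h0 h1 ∈ sieve y := by
  rw [mem_sieve_iff] at *
  intro a b hab hy
  simp [mixture, hF a b hab hy, hG a b hab hy]

lemma convDensity_mixture {f : ℝ → ℝ} {B : ℝ} (hf : Measurable f) (hf0 : ∀ x, 0 ≤ f x)
    (hB : ∀ x, f x ≤ B) (F G : ProbabilityMeasure ℝ) {t : ℝ} (h0 : 0 ≤ t) (h1 : t ≤ 1) (z : ℝ) :
    convDensity f (mixture F G t h0 h1) z = (1 - t) * convDensity f F z + t * convDensity f G z := by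
  have hi := fun (μ : Measure ℝ) [IsFiniteMeasure μ] => integrable_comp_sub hf hf0 hB μ z
  simp only [convDensity, mixture, ProbabilityMeasure.coe_mk]
  rw [integral_add_measure ((hi _).smul_measure (by simp)) ((hi _).smul_measure (by simp)),
    integral_smul_measure, integral_smul_measure, ENNReal.toReal_ofReal (by linarith),
    ENNReal.toReal_ofReal h0, smul_eq_mul, smul_eq_mul]

lemma convDensity_pos_of_logLikelihood_ne_bot {f : ℝ → ℝ} (hn : 0 < n)
    {F : ProbabilityMeasure ℝ} (h : logLikelihood f y F ≠ ⊥) (i : Fin n) :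
    0 < convDensity f F (y i) := by
  by_contra hneg
  push Not at hneg
  apply h
  have hn' : (0 : ℝ) < (n : ℝ)⁻¹ := by positivity
  rw [logLikelihood, ← Finset.add_sum_erase _ _ (Finset.mem_univ i),
    ENNReal.ofReal_of_nonpos hneg, ENNReal.log_zero, EReal.bot_add,
    EReal.coe_mul_bot_of_pos hn']

lemma logLikelihood_of_pos {f : ℝ → ℝ} {F : ProbabilityMeasure ℝ}
    (h : ∀ i, 0 < convDensity f F (y i)) :
    logLikelihood f y F = (((n : ℝ)⁻¹ * ∑ i, Real.log (convDensity f F (y i)) : ℝ) : EReal) := by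
  rw [logLikelihood, EReal.coe_mul]
  congr 1
  have e : ∀ i, ENNReal.log (ENNReal.ofReal (convDensity f F (y i))) =
      ((Real.log (convDensity f F (y i)) : ℝ) : EReal) := fun i => ENNReal.log_ofReal_of_pos (h i)
  simp_rw [e]
  exact (map_sum (⟨⟨Real.toEReal, EReal.coe_zero⟩, EReal.coe_add⟩ : ℝ →+ EReal) _ _).symm

/-- First-order condition at the endpoint `p` of the segment from `p` to `q`. The inequality `1 - 1
/ x ≤ log x` replaces differentiation, followed by `t → 0`. -/
lemma sum_div_le_card_of_sum_log_le {ι : Type*} {s : Finset ι} {p q : ι → ℝ}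
    (hp : ∀ i ∈ s, 0 < p i) (hq : ∀ i ∈ s, 0 ≤ q i)
    (h : ∀ t, 0 < t → t < 1 →
      ∑ i ∈ s, Real.log ((1 - t) * p i + t * q i) ≤ ∑ i ∈ s, Real.log (p i)) :
    ∑ i ∈ s, q i / p i ≤ s.card := by
  have hpos : ∀ t, 0 < t → t < 1 → ∀ i ∈ s, 0 < (1 - t) * p i + t * q i := fun t h0 h1 i hi =>
    add_pos_of_pos_of_nonneg (mul_pos (by linarith) (hp i hi)) (mul_nonneg h0.le (hq i hi))
  have key : ∀ t, 0 < t → t < 1 →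
      ∑ i ∈ s, (q i - p i) / ((1 - t) * p i + t * q i) ≤ 0 := by
    intro t h0 h1
    have hlog : ∀ i ∈ s, t * ((q i - p i) / ((1 - t) * p i + t * q i)) ≤
        Real.log ((1 - t) * p i + t * q i) - Real.log (p i) := by
      intro i hi
      have hw := hpos t h0 h1 i hi
      have hpi := hp i hi
      rw [← Real.log_div hw.ne' hpi.ne']
      refine le_trans (le_of_eq ?_) (Real.one_sub_inv_le_log_of_pos (div_pos hw hpi))
      rw [inv_div, eq_sub_iff_add_eq, ← mul_div_assoc, ← add_div, div_eq_one_iff_eq hw.ne']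
      ring
    have hs := Finset.sum_le_sum hlog
    rw [← Finset.mul_sum, Finset.sum_sub_distrib] at hs
    have := h t h0 h1
    by_contra hne
    push Not at hne
    have := mul_pos h0 hne
    linarith
  have hlim : Tendsto (fun t : ℝ => ∑ i ∈ s, (q i - p i) / ((1 - t) * p i + t * q i)) (𝓝[>] 0)
      (𝓝 (∑ i ∈ s, (q i - p i) / p i)) := by
    refine tendsto_finsetSum _ fun i hi => ?_
    have hd : Tendsto (fun t : ℝ => (1 - t) * p i + t * q i) (𝓝[>] 0) (𝓝 (p i)) := by
      have : Tendsto (fun t : ℝ => (1 - t) * p i + t * q i) (𝓝 0) (𝓝 ((1 - 0) * p i + 0 * q i)) :=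
        Continuous.tendsto (by fun_prop) 0
      simp only [sub_zero, one_mul, zero_mul, add_zero] at this
      exact this.mono_left nhdsWithin_le_nhds
    exact tendsto_const_nhds.div hd (hp i hi).ne'
  have hle : ∑ i ∈ s, (q i - p i) / p i ≤ 0 := by
    refine le_of_tendsto hlim ?_
    filter_upwards [Ioo_mem_nhdsGT (zero_lt_one' ℝ)] with t ht using key t ht.1 ht.2
  have e : ∑ i ∈ s, (q i - p i) / p i = ∑ i ∈ s, q i / p i - s.card := by
    rw [Finset.card_eq_sum_ones, Nat.cast_sum, ← Finset.sum_sub_distrib]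
    refine Finset.sum_congr rfl fun i hi => ?_
    rw [sub_div, div_self (hp i hi).ne', Nat.cast_one]
  linarith

/-- The likelihood equation as an inequality: the mean of the density ratios of a competitor in
the sieve and a maximum likelihood estimator is at most one. -/
lemma IsMLE.sum_div_le {f : ℝ → ℝ} {B : ℝ} (hf : Measurable f) (hf0 : ∀ x, 0 ≤ f x)
    (hB : ∀ x, f x ≤ B) (hn : 0 < n) {F G : ProbabilityMeasure ℝ} (hF : IsMLE f y F)
    (hpos : ∀ i, 0 < convDensity f F (y i)) (hG : G ∈ sieve y) :
    ∑ i, convDensity f G (y i) / convDensity f F (y i) ≤ n := by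
  have := sum_div_le_card_of_sum_log_le (s := Finset.univ)
    (p := fun i => convDensity f F (y i)) (q := fun i => convDensity f G (y i))
    (fun i _ => hpos i) (fun i _ => convDensity_nonneg hf0 G _) ?_
  · simpa using this
  intro t h0 h1
  have hle := hF.2 _ (mixture_mem_sieve hF.1 hG h0.le h1.le)
  have hmix := convDensity_mixture hf hf0 hB F G h0.le h1.le
  rw [logLikelihood_of_pos hpos, logLikelihood_of_pos, EReal.coe_le_coe_iff] at hle
  · have := le_of_mul_le_mul_left hle (by positivity)
    simpa only [hmix] using this
  · intro i
    rw [hmix]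
    exact add_pos_of_pos_of_nonneg (mul_pos (by linarith) (hpos i))
      (mul_nonneg h0.le (convDensity_nonneg hf0 G _))

lemma IsMLE.convDensity_pos {f : ℝ → ℝ} (hn : 0 < n) {F : ProbabilityMeasure ℝ} (hF : IsMLE f y F)
    (h : ∃ G ∈ sieve y, logLikelihood f y G ≠ ⊥) (i : Fin n) : 0 < convDensity f F (y i) := by
  obtain ⟨G, hG, hne⟩ := h
  refine convDensity_pos_of_logLikelihood_ne_bot hn (fun hbot => hne ?_) i
  exact le_bot_iff.1 (hbot ▸ hF.2 G hG)

end Sieve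

/-! ### Empirical measures -/

section Empirical

open scoped ENNReal

/-- The empirical measure of `y 0, …, y (n - 1)`. -/
def empiricalMeasure (y : ℕ → ℝ) (n : ℕ) : Measure ℝ :=
  (n : ℝ≥0∞)⁻¹ • ∑ i ∈ Finset.range n, Measure.dirac (y i)

variable {y : ℕ → ℝ} {n : ℕ}

lemma isProbabilityMeasure_empiricalMeasure (hn : 0 < n) :
    IsProbabilityMeasure (empiricalMeasure y n) := by
  constructor
  simp only [empiricalMeasure, Measure.smul_apply, Measure.coe_finsetSum, Finset.sum_apply,
    measure_univ, Finset.sum_const, Finset.card_range, smul_eq_mul, nsmul_eq_mul, mul_one]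
  exact ENNReal.inv_mul_cancel (by exact_mod_cast hn.ne') (by simp)

lemma integral_empiricalMeasure (φ : ℝ → ℝ) (y : ℕ → ℝ) (n : ℕ) :
    ∫ x, φ x ∂(empiricalMeasure y n) = (n : ℝ)⁻¹ * ∑ i ∈ Finset.range n, φ (y i) := by
  rw [empiricalMeasure, integral_smul_measure, integral_finsetSum_measure]
  · simp
  · intro i _
    exact integrable_dirac (by simp)

lemma empiricalMeasure_real_Iic (y : ℕ → ℝ) (n : ℕ) (x : ℝ) :
    (empiricalMeasure y n).real (Iic x) =
      (∑ i ∈ Finset.range n, (Iic x).indicator (fun _ => (1 : ℝ)) (y i)) / n := by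
  rw [← integral_indicator_one measurableSet_Iic, integral_empiricalMeasure, div_eq_inv_mul]
  rfl

end Empirical

/-! ### Limits of distributions on the extended line -/

section Compactification

/-- A distribution on the line, regarded as a distribution on the extended line. -/
def toERealMeasure (F : ProbabilityMeasure ℝ) : ProbabilityMeasure EReal :=
  F.map EReal.measurableEmbedding_coe.measurable.aemeasurable

/-- The function `x ↦ f (y - x)`, extended by zero to the extended line. -/
def extendedKernel (f : ℝ → ℝ) (y : ℝ) : EReal → ℝ :=
  Function.extend Real.toEReal (fun x => f (y - x)) 0

variable {f m : ℝ → ℝ} {V B : ℝ}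

@[simp]
lemma extendedKernel_coe (f : ℝ → ℝ) (y x : ℝ) : extendedKernel f y x = f (y - x) :=
  EReal.coe_injective.extend_apply _ _ _

@[simp]
lemma extendedKernel_top (f : ℝ → ℝ) (y : ℝ) : extendedKernel f y ⊤ = 0 :=
  Function.extend_apply' _ _ _ (by simp)

@[simp]
lemma extendedKernel_bot (f : ℝ → ℝ) (y : ℝ) : extendedKernel f y ⊥ = 0 :=
  Function.extend_apply' _ _ _ (by simp)

lemma measurable_extendedKernel (hf : Measurable f) (y : ℝ) : Measurable (extendedKernel f y) :=
  EReal.measurableEmbedding_coe.measurable_extend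
    (hf.comp (measurable_const.sub measurable_id)) measurable_zero

lemma extendedKernel_nonneg (h0 : ∀ x, 0 ≤ f x) (y : ℝ) (x : EReal) : 0 ≤ extendedKernel f y x := by
  induction x <;> simp [h0]

lemma extendedKernel_le (h0 : ∀ x, 0 ≤ f x) (hB : ∀ x, f x ≤ B) (y : ℝ) (x : EReal) :
    extendedKernel f y x ≤ B := by
  induction x <;> simp [hB, (h0 0).trans (hB 0)]

lemma continuousAt_extendedKernel_coe {y x : ℝ} (h : ContinuousAt f (y - x)) :
    ContinuousAt (extendedKernel f y) x := by
  rw [← EReal.isOpenEmbedding_coe.continuousAt_iff]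
  have e : extendedKernel f y ∘ Real.toEReal = fun x => f (y - x) := by ext; simp
  rw [e]
  exact ContinuousAt.comp (f := fun x => y - x) h (by fun_prop)

/-- The sign flips: `x → ⊤` means `y - x → -∞`. -/
lemma continuousAt_extendedKernel_top (h : Tendsto f atBot (𝓝 0)) (y : ℝ) :
    ContinuousAt (extendedKernel f y) ⊤ := by
  rw [ContinuousAt, extendedKernel_top, Metric.tendsto_nhds]
  intro ε hε
  obtain ⟨a, ha⟩ := eventually_atBot.1 (Metric.tendsto_nhds.1 h ε hε)
  filter_upwards [EReal.nhds_top_basis.mem_of_mem (i := y - a) trivial] with x hx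
  induction x with
  | bot => simpa using hε
  | top => simpa using hε
  | coe x =>
    rw [extendedKernel_coe]
    refine ha _ ?_
    have : y - a < x := EReal.coe_lt_coe_iff.1 hx
    linarith

lemma continuousAt_extendedKernel_bot (h : Tendsto f atTop (𝓝 0)) (y : ℝ) :
    ContinuousAt (extendedKernel f y) ⊥ := by
  rw [ContinuousAt, extendedKernel_bot, Metric.tendsto_nhds]
  intro ε hε
  obtain ⟨a, ha⟩ := eventually_atTop.1 (Metric.tendsto_nhds.1 h ε hε)
  filter_upwards [EReal.nhds_bot_basis.mem_of_mem (i := y - a) trivial] with x hx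
  induction x with
  | bot => simpa using hε
  | top => simpa using hε
  | coe x =>
    rw [extendedKernel_coe]
    refine ha _ ?_
    have : x < y - a := EReal.coe_lt_coe_iff.1 hx
    linarith

lemma integral_extendedKernel_toERealMeasure (f : ℝ → ℝ) (F : ProbabilityMeasure ℝ)
    (y : ℝ) : ∫ x, extendedKernel f y x ∂(toERealMeasure F : Measure EReal) = convDensity f F y := by
  rw [toERealMeasure, ProbabilityMeasure.toMeasure_map,
    EReal.measurableEmbedding_coe.integral_map]
  simp [convDensity]

/-- The kernel is zero at `±∞`, so mass escaped to infinity contributes nothing. -/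
lemma integral_extendedKernel (f : ℝ → ℝ) (μ : Measure EReal) (y : ℝ) :
    ∫ x, extendedKernel f y x ∂μ = ∫ x, f (y - x) ∂(μ.comap Real.toEReal) := by
  have h := EReal.measurableEmbedding_coe.integral_map (μ := μ.comap Real.toEReal)
    (extendedKernel f y)
  rw [EReal.measurableEmbedding_coe.map_comap, setIntegral_eq_integral_of_forall_compl_eq_zero] at h
  · simpa using h
  · intro x hx
    exact Function.extend_apply' _ _ _ hx

lemma ae_ae_continuousAt_extendedKernel (hf : DominatedBy f m V) (htop : Tendsto f atTop (𝓝 0))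
    (hbot : Tendsto f atBot (𝓝 0)) (μ : Measure EReal) [IsFiniteMeasure μ] :
    ∀ᵐ y, ∀ᵐ x ∂μ, ContinuousAt (extendedKernel f y) x := by
  filter_upwards [ae_ae_continuousAt_sub hf (μ.comap Real.toEReal)] with y hy
  rw [ae_iff] at hy ⊢
  rw [EReal.measurableEmbedding_coe.comap_apply] at hy
  refine measure_mono_null (fun x hx => ?_) hy
  induction x with
  | bot => exact (hx (continuousAt_extendedKernel_bot htop y)).elim
  | top => exact (hx (continuousAt_extendedKernel_top hbot y)).elim
  | coe x => exact ⟨x, fun h => hx (continuousAt_extendedKernel_coe h), rfl⟩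

lemma ae_tendsto_convDensity (hf : DominatedBy f m V) (h0 : ∀ x, 0 ≤ f x) (hB : ∀ x, f x ≤ B)
    (htop : Tendsto f atTop (𝓝 0)) (hbot : Tendsto f atBot (𝓝 0))
    {F : ℕ → ProbabilityMeasure ℝ} {μ : ProbabilityMeasure EReal}
    (h : Tendsto (fun n => toERealMeasure (F n)) atTop (𝓝 μ)) :
    ∀ᵐ y, Tendsto (fun n => convDensity f (F n) y) atTop
      (𝓝 (∫ x, f (y - x) ∂((μ : Measure EReal).comap Real.toEReal))) := by
  filter_upwards [ae_ae_continuousAt_extendedKernel hf htop hbot (μ : Measure EReal)] with y hy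
  have := tendsto_integral_of_ae_continuousAt h (measurable_extendedKernel hf.measurable y)
    (extendedKernel_nonneg h0 y) (extendedKernel_le h0 hB y) hy
  simp_rw [integral_extendedKernel_toERealMeasure] at this
  rwa [integral_extendedKernel] at this

lemma toERealMeasure_real_Iic (F : ProbabilityMeasure ℝ) (x : ℝ) :
    (toERealMeasure F : Measure EReal).real (Iic (x : EReal)) = cdf (F : Measure ℝ) x := by
  rw [toERealMeasure, ProbabilityMeasure.toMeasure_map, cdf_eq_real, Measure.real,
    EReal.measurableEmbedding_coe.map_apply]
  congr 2
  ext z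
  simp

lemma tendsto_cdf_of_tendsto_toERealMeasure {F : ℕ → ProbabilityMeasure ℝ}
    {G : ProbabilityMeasure ℝ}
    (h : Tendsto (fun n => toERealMeasure (F n)) atTop (𝓝 (toERealMeasure G))) {x : ℝ}
    (hx : ContinuousAt (cdf (G : Measure ℝ)) x) :
    Tendsto (fun n => cdf (F n : Measure ℝ) x) atTop (𝓝 (cdf (G : Measure ℝ) x)) := by
  rw [continuousAt_cdf_iff] at hx
  have hfr : (toERealMeasure G : Measure EReal) (frontier (Iic (x : EReal))) = 0 := by
    refine measure_mono_null (frontier_Iic_subset _) ?_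
    rw [toERealMeasure, ProbabilityMeasure.toMeasure_map,
      EReal.measurableEmbedding_coe.map_apply]
    convert hx
    ext z
    simp
  have := ProbabilityMeasure.tendsto_measure_of_null_frontier_of_tendsto' h hfr
  have := (ENNReal.tendsto_toReal (measure_ne_top _ _)).comp this
  simp_rw [← toERealMeasure_real_Iic]
  exact this

lemma toERealMeasure_eq_of_comap_eq {G : ProbabilityMeasure ℝ} {μ : ProbabilityMeasure EReal}
    (h : (μ : Measure EReal).comap Real.toEReal = G) : μ = toERealMeasure G := by
  have hmap := EReal.measurableEmbedding_coe.map_comap (μ : Measure EReal)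
  have hrange : (μ : Measure EReal) (range Real.toEReal) = 1 := by
    rw [← Measure.restrict_apply_univ, ← hmap, h,
      EReal.measurableEmbedding_coe.map_apply, preimage_univ, measure_univ]
  apply Subtype.ext
  change (μ : Measure EReal) = (toERealMeasure G : Measure EReal)
  rw [toERealMeasure, ProbabilityMeasure.toMeasure_map]
  rw [← h, hmap, Measure.restrict_eq_self_of_ae_mem]
  exact (prob_compl_eq_zero_iff EReal.measurableEmbedding_coe.measurableSet_range).2 hrange

end Compactification

/-! ### Approximating the true distribution within the sieve -/

section Approximation

variable {f m : ℝ → ℝ} {V B : ℝ}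

/-- The projection of a distribution to the sample `y 0, …, y (n - 1)`. -/
def sampleProjection (y : ℕ → ℝ) (F : ProbabilityMeasure ℝ) (n : ℕ) : ProbabilityMeasure ℝ :=
  F.map (SimpleFunc.nearestPt y (n - 1)).measurable.aemeasurable

lemma sampleProjection_mem_sieve (y : ℕ → ℝ) (F : ProbabilityMeasure ℝ) {n : ℕ} (hn : 0 < n) :
    sampleProjection y F n ∈ sieve (fun i : Fin n => y i) := by
  refine map_mem_sieve F (SimpleFunc.measurable _) fun x =>
    ⟨⟨SimpleFunc.nearestPtInd y (n - 1) x, ?_⟩, rfl⟩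
  -- `nearestPt y (n - 1)` chooses among the `n` points `y 0, …, y (n - 1)`; here `n > 0` is needed.
  have := SimpleFunc.nearestPtInd_le y (n - 1) x
  omega

lemma ae_tendsto_convDensity_sampleProjection (hf : DominatedBy f m V) (h0 : ∀ x, 0 ≤ f x)
    (hB : ∀ x, f x ≤ B) {y : ℕ → ℝ} {F : ProbabilityMeasure ℝ}
    (hy : ∀ᵐ x ∂(F : Measure ℝ), x ∈ closure (range y)) :
    ∀ᵐ z, Tendsto (fun n => convDensity f (sampleProjection y F n) z) atTop
      (𝓝 (convDensity f F z)) := by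
  filter_upwards [ae_ae_continuousAt_sub hf (F : Measure ℝ)] with z hz
  have hmeas : Measurable (fun x => f (z - x)) :=
    hf.measurable.comp (measurable_const.sub measurable_id)
  have e : ∀ n, convDensity f (sampleProjection y F n) z =
      ∫ x, f (z - SimpleFunc.nearestPt y (n - 1) x) ∂(F : Measure ℝ) := fun n => by
    rw [convDensity, sampleProjection, ProbabilityMeasure.toMeasure_map,
      integral_map (SimpleFunc.measurable _).aemeasurable hmeas.aestronglyMeasurable]
  simp_rw [e]
  refine tendsto_integral_of_dominated_convergence (fun _ => B) (fun n => ?_) (by simp)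
    (fun n => Eventually.of_forall fun x => ?_) ?_
  · exact (hmeas.comp (SimpleFunc.measurable _)).aestronglyMeasurable
  · rw [Real.norm_eq_abs, abs_of_nonneg (h0 _)]
    exact hB _
  · filter_upwards [hz, hy] with x hx hxy
    have h1 : Tendsto (fun n : ℕ => SimpleFunc.nearestPt y (n - 1) x) atTop (𝓝 x) :=
      (SimpleFunc.tendsto_nearestPt hxy).comp (tendsto_sub_atTop_nat 1)
    exact Tendsto.comp hx (tendsto_const_nhds.sub h1)

end Approximation

/-! ### Equality of densities from the limiting score inequality -/

section Information

open scoped ENNReal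

/-- If `u` is a probability density, `v` a sub-probability density and `∫ u ^ 2 / v ≤ 1`, then
`u = v` almost everywhere. -/
lemma ae_eq_of_integral_div_le_one {u v : ℝ → ℝ} (hu : Measurable u) (hv : Measurable v)
    (hu0 : ∀ x, 0 ≤ u x) (hv0 : ∀ x, 0 ≤ v x) {B : ℝ} (huB : ∀ x, u x ≤ B)
    {H : Measure ℝ} [IsProbabilityMeasure H]
    (hH : H = volume.withDensity fun x => ENNReal.ofReal (u x))
    (hv1 : ∫⁻ x, ENNReal.ofReal (v x) ≤ 1)
    (h : ∀ δ > 0, ∫ x, u x / (v x + δ) ∂H ≤ 1) : u =ᵐ[volume] v := by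
  have hpos : ∀ᵐ x ∂H, 0 < u x := by
    rw [hH, ae_withDensity_iff hu.ennreal_ofReal]
    exact Eventually.of_forall fun x hx => by
      by_contra hne
      exact hx (ENNReal.ofReal_of_nonpos (not_lt.1 hne))
  set r : ℕ → ℝ → ℝ≥0∞ := fun k x => ENNReal.ofReal (u x / (v x + 1 / ((k : ℝ) + 1)))
  have hδ : ∀ k : ℕ, 0 < 1 / ((k : ℝ) + 1) := fun k => Nat.one_div_pos_of_nat
  have hmeasR : ∀ k : ℕ, Measurable fun x => u x / (v x + 1 / ((k : ℝ) + 1)) := fun k =>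
    hu.div (hv.add_const _)
  have hr1 : ∀ k, ∫⁻ x, r k x ∂H ≤ 1 := by
    intro k
    have hnn : ∀ x, 0 ≤ u x / (v x + 1 / ((k : ℝ) + 1)) := fun x =>
      div_nonneg (hu0 x) (add_nonneg (hv0 x) (hδ k).le)
    have hint : Integrable (fun x => u x / (v x + 1 / ((k : ℝ) + 1))) H := by
      refine Integrable.of_bound (hmeasR k).aestronglyMeasurable (B / (1 / ((k : ℝ) + 1)))
        (Eventually.of_forall fun x => ?_)
      rw [Real.norm_eq_abs, abs_of_nonneg (hnn x)]
      exact div_le_div₀ ((hu0 x).trans (huB x)) (huB x) (hδ k) (by linarith [hv0 x])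
    rw [← ofReal_integral_eq_lintegral_ofReal hint (Eventually.of_forall hnn)]
    exact ENNReal.ofReal_le_one.2 (h _ (hδ k))
  have hfatou : ∫⁻ x, liminf (fun k => r k x) atTop ∂H ≤ 1 := by
    refine (lintegral_liminf_le fun k => (hmeasR k).ennreal_ofReal).trans ?_
    exact liminf_le_of_le (by isBoundedDefault) fun b hb => by
      obtain ⟨k, hk⟩ := hb.exists
      exact hk.trans (hr1 k)
  have hlimδ : Tendsto (fun k : ℕ => 1 / ((k : ℝ) + 1)) atTop (𝓝 0) :=
    tendsto_one_div_add_atTop_nhds_zero_nat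
  -- Where `v = 0 < u`, the ratios tend to infinity, which the Fatou bound allows only on an
  -- `H`-null set.
  have hvpos : ∀ᵐ x ∂H, 0 < v x := by
    have hfin := ae_lt_top (Measurable.liminf fun k => (hmeasR k).ennreal_ofReal)
      (hfatou.trans_lt ENNReal.one_lt_top).ne
    filter_upwards [hpos, hfin] with x hx hfx
    by_contra hne
    have hvx : v x = 0 := le_antisymm (not_lt.1 hne) (hv0 x)
    have ht : Tendsto (fun k => r k x) atTop (𝓝 ⊤) := by
      refine ENNReal.tendsto_ofReal_nhds_top.2 ?_
      have : (fun k : ℕ => u x / (v x + 1 / ((k : ℝ) + 1))) = fun k : ℕ => u x * ((k : ℝ) + 1) := by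
        ext k
        rw [hvx, zero_add, div_div_eq_mul_div, div_one]
      rw [this]
      exact (tendsto_natCast_atTop_atTop.atTop_add tendsto_const_nhds).const_mul_atTop hx
    rw [ht.liminf_eq] at hfx
    exact lt_irrefl _ hfx
  have ha1 : ∫⁻ x, ENNReal.ofReal (u x / v x) ∂H ≤ 1 := by
    refine le_trans (le_of_eq (lintegral_congr_ae ?_)) hfatou
    filter_upwards [hvpos] with x hx
    refine (Tendsto.liminf_eq ?_).symm
    refine ENNReal.tendsto_ofReal (tendsto_const_nhds.div ?_ hx.ne')
    simpa using (tendsto_const_nhds (x := v x)).add hlimδ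
  have huv : Measurable fun x => u x / v x := hu.div hv
  have hvu : Measurable fun x => v x / u x := hv.div hu
  have hb1 : ∫⁻ x, ENNReal.ofReal (v x / u x) ∂H ≤ 1 := by
    rw [hH, lintegral_withDensity_eq_lintegral_mul _ hu.ennreal_ofReal hvu.ennreal_ofReal]
    refine (lintegral_mono fun x => ?_).trans hv1
    simp only [Pi.mul_apply]
    rw [← ENNReal.ofReal_mul (hu0 x)]
    refine ENNReal.ofReal_le_ofReal ?_
    rcases (hu0 x).eq_or_lt with h0 | h0
    · rw [← h0, zero_mul]; exact hv0 x
    · rw [mul_div_cancel₀ _ h0.ne']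
  have hreal : ∀ g : ℝ → ℝ, Measurable g → (∀ x, 0 ≤ g x) → ∫⁻ x, ENNReal.ofReal (g x) ∂H ≤ 1 →
      Integrable g H ∧ ∫ x, g x ∂H ≤ 1 := by
    intro g hg hg0 hg1
    refine ⟨(lintegral_ofReal_ne_top_iff_integrable hg.aestronglyMeasurable
      (Eventually.of_forall hg0)).1 (hg1.trans_lt ENNReal.one_lt_top).ne, ?_⟩
    rw [integral_eq_lintegral_of_nonneg_ae (Eventually.of_forall hg0) hg.aestronglyMeasurable]
    exact ENNReal.toReal_le_of_le_ofReal zero_le_one (by simpa using hg1)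
  obtain ⟨hai, ha⟩ := hreal _ huv (fun x => div_nonneg (hu0 x) (hv0 x)) ha1
  obtain ⟨hbi, hb⟩ := hreal _ hvu (fun x => div_nonneg (hv0 x) (hu0 x)) hb1
  have hid : ∀ x, 0 < u x → 0 < v x → u x / v x + v x / u x - 2 = (u x - v x) ^ 2 / (u x * v x) := by
    intro x h1 h2
    field_simp
    ring
  have hnn : 0 ≤ᵐ[H] fun x => u x / v x + v x / u x - 2 := by
    filter_upwards [hpos, hvpos] with x h1 h2
    rw [hid x h1 h2]
    exact div_nonneg (sq_nonneg _) (mul_pos h1 h2).le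
  have hzero : (fun x => u x / v x + v x / u x - 2) =ᵐ[H] 0 := by
    have hadd : Integrable (fun x => u x / v x + v x / u x) H := hai.add hbi
    have hint : Integrable (fun x => u x / v x + v x / u x - 2) H :=
      hadd.sub (integrable_const (2 : ℝ))
    rw [← integral_eq_zero_iff_of_nonneg_ae hnn hint]
    refine le_antisymm ?_ (integral_nonneg_of_ae hnn)
    rw [integral_sub hadd (integrable_const _), integral_add hai hbi]
    simp only [integral_const, probReal_univ, smul_eq_mul, one_mul]
    linarith
  have heq : ∀ᵐ x ∂H, u x = v x := by
    filter_upwards [hpos, hvpos, hzero] with x h1 h2 h3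
    rw [hid x h1 h2] at h3
    have := (div_eq_zero_iff.1 h3).resolve_right (mul_pos h1 h2).ne'
    exact sub_eq_zero.1 (pow_eq_zero_iff two_ne_zero |>.1 this)
  rw [hH, ae_withDensity_iff hu.ennreal_ofReal] at heq
  -- Equality is known only where `u > 0`; elsewhere `u = 0 ≤ v`. Since `∫ v ≤ 1 = ∫ u`, no excess
  -- of `v` is possible.
  have hle : (fun x => ENNReal.ofReal (u x)) ≤ᵐ[volume] fun x => ENNReal.ofReal (v x) := by
    filter_upwards [heq] with x hx
    by_cases h0 : ENNReal.ofReal (u x) = 0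
    · rw [h0]; exact zero_le
    · rw [hx h0]
  have hu1 : ∫⁻ x, ENNReal.ofReal (u x) = 1 := by
    rw [← setLIntegral_univ, ← withDensity_apply _ MeasurableSet.univ, ← hH, measure_univ]
  have := ae_eq_of_ae_le_of_lintegral_le hle (by rw [hu1]; simp) hv.ennreal_ofReal.aemeasurable
    (by rw [hu1]; exact hv1)
  filter_upwards [this] with x hx
  exact (ENNReal.ofReal_eq_ofReal_iff (hu0 x) (hv0 x)).1 hx

end Information

/-! ### Consistency along a sample path and almost surely -/

section Consistency

variable {f m : ℝ → ℝ} {V B : ℝ}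

/-- If an interval misses the sample, the empirical masses to the left of its two ends coincide for
every `n`, so in the limit `H` cannot charge it. -/
lemma subset_closure_range_of_support {H : Measure ℝ} [IsProbabilityMeasure H]
    {y : ℕ → ℝ}
    (hunif : ∀ η > 0, ∀ᶠ n in atTop, ∀ S : Set ℝ, IsLowerSet S →
      |(empiricalMeasure y n).real S - H.real S| ≤ η) :
    H.support ⊆ closure (range y) := by
  intro x hx
  by_contra hxc
  obtain ⟨ε, hε, hball⟩ := Metric.isOpen_iff.1 isClosed_closure.isOpen_compl x hxc
  rw [Real.ball_eq_Ioo] at hball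
  have hpos : 0 < H.real (Iio (x + ε)) - H.real (Iic (x - ε)) := by
    have h1 : 0 < H (Ioo (x - ε) (x + ε)) :=
      (Measure.mem_support_iff_forall x).1 hx _ (Ioo_mem_nhds (by linarith) (by linarith))
    have h2 : Iio (x + ε) \ Iic (x - ε) = Ioo (x - ε) (x + ε) := by
      ext z; simp [and_comm]
    have hsub : Iic (x - ε) ⊆ Iio (x + ε) := fun z hz =>
      lt_of_le_of_lt (mem_Iic.1 hz) (by linarith)
    rw [← measureReal_sdiff hsub measurableSet_Iic, h2]
    exact ENNReal.toReal_pos h1.ne' (measure_ne_top _ _)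
  have hemp : ∀ n, (empiricalMeasure y n).real (Iio (x + ε)) =
      (empiricalMeasure y n).real (Iic (x - ε)) := by
    intro n
    rw [← integral_indicator_one measurableSet_Iio, ← integral_indicator_one measurableSet_Iic,
      integral_empiricalMeasure, integral_empiricalMeasure]
    congr 1
    refine Finset.sum_congr rfl fun i _ => ?_
    have hi : y i ∉ Ioo (x - ε) (x + ε) := fun h => hball h (subset_closure (mem_range_self i))
    have hiff : y i ∈ Iio (x + ε) ↔ y i ∈ Iic (x - ε) := by
      simp only [mem_Ioo, not_and, not_lt] at hi
      simp only [mem_Iio, mem_Iic]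
      constructor
      · intro h
        by_contra hne
        exact absurd (hi (not_le.1 hne)) (not_le.2 h)
      · intro h
        linarith
    by_cases h : y i ∈ Iic (x - ε)
    · rw [indicator_of_mem h, indicator_of_mem (hiff.2 h)]
    · rw [indicator_of_notMem h, indicator_of_notMem (fun h' => h (hiff.1 h'))]
  obtain ⟨n, hn⟩ := (hunif _ (div_pos hpos (by norm_num : (0 : ℝ) < 4))).exists
  have h1 := abs_le.1 (hn _ (isLowerSet_Iio (x + ε)))
  have h2 := abs_le.1 (hn _ (isLowerSet_Iic (x - ε)))
  rw [hemp n] at h1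
  linarith [h1.1, h2.2]

/-- In the limit along a subsequence of maximum likelihood estimators, the score inequality is
preserved. -/
lemma integral_div_add_le_one (hf : DominatedBy f m V) (h0 : ∀ x, 0 ≤ f x) (hB : ∀ x, f x ≤ B)
    (htop : Tendsto f atTop (𝓝 0)) (hbot : Tendsto f atBot (𝓝 0))
    {FX : ProbabilityMeasure ℝ} {H : Measure ℝ} [IsProbabilityMeasure H] (hH : H ≪ volume)
    {y : ℕ → ℝ}
    (hunif : ∀ η > 0, ∀ᶠ n in atTop, ∀ S : Set ℝ, IsLowerSet S →
      |(empiricalMeasure y n).real S - H.real S| ≤ η)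
    (hFX : ∀ᵐ x ∂(FX : Measure ℝ), x ∈ closure (range y))
    {Fhat : ℕ → ProbabilityMeasure ℝ}
    (hMLE : ∀ᶠ n : ℕ in atTop, IsMLE f (fun i : Fin n => y i) (Fhat n) ∧
      ∀ i : Fin n, 0 < convDensity f (Fhat n) (y i))
    {ns : ℕ → ℕ} (hns : Tendsto ns atTop atTop) {μ : ProbabilityMeasure EReal}
    (hμ : Tendsto (fun k => toERealMeasure (Fhat (ns k))) atTop (𝓝 μ)) {δ : ℝ} (hδ : 0 < δ) :
    ∫ z, convDensity f FX z /
      ((∫ x, f (z - x) ∂((μ : Measure EReal).comap Real.toEReal)) + δ) ∂H ≤ 1 := by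
  have hB0 : 0 ≤ B := (h0 0).trans (hB 0)
  have hV := hf.bound_nonneg
  set G := sampleProjection y FX
  set φ : ℕ → ℝ → ℝ := fun n z => convDensity f (G n) z / (convDensity f (Fhat n) z + δ)
  have hφ0 : ∀ n z, 0 ≤ φ n z := fun n z => div_nonneg (convDensity_nonneg h0 _ _)
    (add_nonneg (convDensity_nonneg h0 _ _) hδ.le)
  have hφB : ∀ n z, φ n z ≤ B / δ := fun n z =>
    div_le_div₀ hB0 (convDensity_le hf.measurable h0 hB _ _) hδ
      (by linarith [convDensity_nonneg h0 (Fhat n) z])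
  have hφ := fun n => (hf.convDensity h0 hB (G n)).div_add (hf.convDensity h0 hB (Fhat n))
    (convDensity_nonneg h0 _) (convDensity_le hf.measurable h0 hB _) (convDensity_nonneg h0 _) hδ
  -- The Koksma constant of `φ n`, the same for all `n`.
  set C := 2 * (V / δ + B / δ ^ 2 * V) + B / δ
  have hC : 0 ≤ C := by positivity
  have hlim : Tendsto (fun k => ∫ z, φ (ns k) z ∂H) atTop (𝓝 (∫ z, convDensity f FX z /
      ((∫ x, f (z - x) ∂((μ : Measure EReal).comap Real.toEReal)) + δ) ∂H)) := by
    refine tendsto_integral_of_dominated_convergence (fun _ => B / δ)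
      (fun k => (hφ (ns k)).measurable.aestronglyMeasurable) (by simp)
      (fun k => Eventually.of_forall fun z => ?_) ?_
    · rw [Real.norm_eq_abs, abs_of_nonneg (hφ0 _ _)]
      exact hφB _ _
    · filter_upwards [hH.ae_le (ae_tendsto_convDensity hf h0 hB htop hbot hμ),
        hH.ae_le (ae_tendsto_convDensity_sampleProjection hf h0 hB hFX)] with z h1 h2
      refine (h2.comp hns).div (h1.add_const δ) ?_
      exact (add_pos_of_nonneg_of_pos (integral_nonneg fun _ => h0 _) hδ).ne'
  have hemp : ∀ᶠ n in atTop, ∫ z, φ n z ∂(empiricalMeasure y n) ≤ 1 := by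
    filter_upwards [hMLE, eventually_gt_atTop 0] with n hn hn0
    have hn' : (0 : ℝ) < n := by exact_mod_cast hn0
    have hs := hn.1.sum_div_le hf.measurable h0 hB hn0 hn.2 (sampleProjection_mem_sieve y FX hn0)
    rw [integral_empiricalMeasure, inv_mul_le_iff₀ hn', mul_one, Finset.sum_range]
    refine (Finset.sum_le_sum fun i _ => ?_).trans hs
    -- Adding `δ` to the denominator only lowers the ratio, so the score inequality survives.
    exact div_le_div_of_nonneg_left (convDensity_nonneg h0 _ _) (hn.2 i) (by linarith)
  have hbound : ∀ η > 0, ∀ᶠ n in atTop, ∫ z, φ n z ∂H ≤ 1 + C * η := by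
    intro η hη
    filter_upwards [hemp, hunif η hη, eventually_gt_atTop 0] with n h1 h2 h3
    have := isProbabilityMeasure_empiricalMeasure (y := y) h3
    have := abs_le.1 ((hφ n).abs_integral_sub_le (hφ0 n) (hφB n) h2)
    linarith [this.1]
  have hle : ∀ η > 0, ∫ z, convDensity f FX z /
      ((∫ x, f (z - x) ∂((μ : Measure EReal).comap Real.toEReal)) + δ) ∂H ≤ 1 + C * η :=
    fun η hη => le_of_tendsto hlim (hns.eventually (hbound η hη))
  refine le_of_forall_pos_le_add fun ε hε => (hle (ε / (C + 1)) (by positivity)).trans ?_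
  have : C * (ε / (C + 1)) ≤ ε := by
    rw [mul_div_assoc', div_le_iff₀ (by positivity)]
    nlinarith
  linarith

/-- Consistency along a single sample path, in the compactified line. -/
lemma tendsto_toERealMeasure_of_isMLE (hf : f ∈ NoiseClass) (hident : Identifiable f)
    {FX : ProbabilityMeasure ℝ} [IsProbabilityMeasure (convLaw f FX)]
    {y : ℕ → ℝ}
    (hunif : ∀ η > 0, ∀ᶠ n in atTop, ∀ S : Set ℝ, IsLowerSet S →
      |(empiricalMeasure y n).real S - (convLaw f FX).real S| ≤ η)
    (hsupp : (FX : Measure ℝ).support ⊆ (convLaw f FX).support)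
    (hlik : ∀ᶠ n : ℕ in atTop, ∃ F ∈ sieve (fun i : Fin n => y i),
      logLikelihood f (fun i : Fin n => y i) F ≠ ⊥)
    {Fhat : ℕ → ProbabilityMeasure ℝ}
    (hMLE : ∀ n : ℕ, 1 ≤ n → IsMLE f (fun i : Fin n => y i) (Fhat n)) :
    Tendsto (fun n => toERealMeasure (Fhat n)) atTop (𝓝 (toERealMeasure FX)) := by
  obtain ⟨m, V, hm⟩ := NoiseClass.exists_dominatedBy hf
  have htop := NoiseClass.tendsto_atTop hf
  have hbot := NoiseClass.tendsto_atBot hf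
  obtain ⟨h0, -, hi, h1, -⟩ := hf
  obtain ⟨B, hB⟩ : ∃ B, ∀ x, f x ≤ B :=
    ⟨f 0 + V, fun x => by linarith [abs_le.1 (hm.abs_sub_le_bound 0 x)]⟩
  have hac : convLaw f FX ≪ volume := withDensity_absolutelyContinuous _ _
  have hFX : ∀ᵐ x ∂(FX : Measure ℝ), x ∈ closure (range y) := by
    filter_upwards [Measure.support_mem_ae (μ := (FX : Measure ℝ))] with x hx
    exact subset_closure_range_of_support hunif (hsupp hx)
  have hMLE' : ∀ᶠ n : ℕ in atTop, IsMLE f (fun i : Fin n => y i) (Fhat n) ∧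
      ∀ i : Fin n, 0 < convDensity f (Fhat n) (y i) := by
    filter_upwards [hlik, eventually_ge_atTop 1] with n hn hn1
    exact ⟨hMLE n hn1, (hMLE n hn1).convDensity_pos hn1 hn⟩
  refine tendsto_of_subseq_tendsto fun ns hns => ?_
  obtain ⟨μ, ks, hks, hμ⟩ :=
    SeqCompactSpace.tendsto_subseq (fun k => toERealMeasure (Fhat (ns k)))
  refine ⟨ks, ?_⟩
  set ν := (μ : Measure EReal).comap Real.toEReal
  have hνle : ν univ ≤ 1 := by
    rw [EReal.measurableEmbedding_coe.comap_apply]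
    exact prob_le_one
  have hfin : IsFiniteMeasure ν := ⟨hνle.trans_lt ENNReal.one_lt_top⟩
  have hden : convDensity f FX =ᵐ[volume] fun z => ∫ x, f (z - x) ∂ν := by
    refine ae_eq_of_integral_div_le_one (H := convLaw f FX) (hm.convDensity h0 hB FX).measurable
      (measurable_integral_comp_sub hm.measurable ν) (convDensity_nonneg h0 FX)
      (fun z => integral_nonneg fun _ => h0 _) (convDensity_le hm.measurable h0 hB FX) rfl
      ((lintegral_ofReal_integral_comp_sub hm.measurable h0 hB hi h1 ν).trans_le hνle) ?_
    intro δ hδ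
    exact integral_div_add_le_one hm h0 hB htop hbot hac hunif hFX hMLE'
      (hns.comp hks.tendsto_atTop) hμ hδ
  -- The mass of `ν` is `∫ f * dν = ∫ f * dFX = 1`.
  have hν : IsProbabilityMeasure ν := by
    constructor
    rw [← lintegral_ofReal_integral_comp_sub hm.measurable h0 hB hi h1 ν,
      lintegral_congr_ae (hden.mono fun z hz => congrArg ENNReal.ofReal hz.symm)]
    exact (lintegral_ofReal_integral_comp_sub hm.measurable h0 hB hi h1 (FX : Measure ℝ)).trans
      measure_univ
  have hFXν : FX = ⟨ν, hν⟩ := hident _ _ hden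
  rw [← toERealMeasure_eq_of_comap_eq (G := FX) (μ := μ) (by rw [hFXν]; rfl)]
  exact hμ

/-- The Glivenko–Cantelli theorem for a continuous distribution function, uniformly over lower
sets. -/
lemma ae_eventually_abs_empiricalMeasure_sub_le {Ω : Type*} [MeasurableSpace Ω] {P : Measure Ω}
    [IsProbabilityMeasure P] {H : Measure ℝ} [IsProbabilityMeasure H] (hH : Continuous (cdf H))
    {Y : ℕ → Ω → ℝ} (hYmeas : ∀ i, Measurable (Y i)) (hYindep : iIndepFun Y P)
    (hYlaw : ∀ i, P.map (Y i) = H) :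
    ∀ᵐ ω ∂P, ∀ η > 0, ∀ᶠ n in atTop, ∀ S : Set ℝ, IsLowerSet S →
      |(empiricalMeasure (fun i => Y i ω) n).real S - H.real S| ≤ η := by
  have hslln : ∀ x : ℝ, ∀ᵐ ω ∂P,
      Tendsto (fun n => (empiricalMeasure (fun i => Y i ω) n).real (Iic x)) atTop
        (𝓝 (H.real (Iic x))) := by
    intro x
    set g : ℝ → ℝ := (Iic x).indicator fun _ => 1
    have hg : Measurable g := measurable_const.indicator measurableSet_Iic
    have hid : ∀ i, IdentDistrib (Y i) (Y 0) P P := fun i =>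
      ⟨(hYmeas i).aemeasurable, (hYmeas 0).aemeasurable, by rw [hYlaw, hYlaw]⟩
    have hint : Integrable (g ∘ Y 0) P := by
      refine Integrable.of_bound (hg.comp (hYmeas 0)).aestronglyMeasurable 1
        (Eventually.of_forall fun ω => ?_)
      by_cases h : Y 0 ω ∈ Iic x <;> simp [g, h]
    have := strong_law_ae_real (fun i => g ∘ Y i) hint
      (fun i j hij => (hYindep.indepFun hij).comp hg hg) (fun i => (hid i).comp hg)
    have hmean : ∫ ω, (g ∘ Y 0) ω ∂P = H.real (Iic x) := by
      rw [← integral_indicator_one measurableSet_Iic, ← hYlaw 0,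
        integral_map (hYmeas 0).aemeasurable
          (measurable_one.indicator measurableSet_Iic).aestronglyMeasurable]
      rfl
    rw [hmean] at this
    filter_upwards [this] with ω hω
    simp_rw [empiricalMeasure_real_Iic]
    exact hω
  -- Rational quantiles suffice, so only countably many exceptional null sets are discarded.
  have hq : ∀ q : ℚ, ∃ x, 0 < (q : ℝ) → (q : ℝ) < 1 → H.real (Iic x) = q := by
    intro q
    by_cases h : 0 < (q : ℝ) ∧ (q : ℝ) < 1
    · obtain ⟨x, hx⟩ := exists_measureReal_Iic_eq hH h.1 h.2
      exact ⟨x, fun _ _ => hx⟩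
    · exact ⟨0, fun h1 h2 => (h ⟨h1, h2⟩).elim⟩
  choose x hx using hq
  filter_upwards [ae_all_iff.2 fun q : ℚ => hslln (x q)] with ω hω η hη
  refine eventually_abs_sub_le_of_quantiles ?_ (fun q h0 h1 => ⟨x q, hx q h0 h1, ?_⟩) hη
  · filter_upwards [eventually_gt_atTop 0] with n hn using isProbabilityMeasure_empiricalMeasure hn
  · rw [← hx q h0 h1]
    exact hω q

lemma tendsto_iSup_abs_cdf_sub {F : ℕ → ProbabilityMeasure ℝ} {G : ProbabilityMeasure ℝ}
    (hG : Continuous (cdf (G : Measure ℝ)))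
    (h : ∀ x, Tendsto (fun n => cdf (F n : Measure ℝ) x) atTop (𝓝 (cdf (G : Measure ℝ) x))) :
    Tendsto (fun n => ⨆ x : ℝ, |cdf (F n : Measure ℝ) x - cdf (G : Measure ℝ) x|) atTop (𝓝 0) := by
  rw [Metric.tendsto_nhds]
  intro ε hε
  have hev := eventually_abs_sub_le_of_quantiles (l := atTop) (μ := fun n => (F n : Measure ℝ))
    (ν := (G : Measure ℝ)) (Eventually.of_forall fun n => inferInstance)
    (fun q h0 h1 => by
      obtain ⟨x, hx⟩ := exists_measureReal_Iic_eq hG h0 h1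
      refine ⟨x, hx, ?_⟩
      have := h x
      simp_rw [cdf_eq_real, hx] at this
      exact this) (half_pos hε)
  filter_upwards [hev] with n hn
  have hle : ⨆ x : ℝ, |cdf (F n : Measure ℝ) x - cdf (G : Measure ℝ) x| ≤ ε / 2 :=
    ciSup_le fun x => by
      rw [cdf_eq_real, cdf_eq_real]
      exact hn _ (isLowerSet_Iic x)
  have h0 : 0 ≤ ⨆ x : ℝ, |cdf (F n : Measure ℝ) x - cdf (G : Measure ℝ) x| :=
    Real.iSup_nonneg fun x => abs_nonneg _
  rw [Real.dist_eq, sub_zero, abs_of_nonneg h0]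
  linarith

end Consistency

end Deconvolution

end

/-- Strong consistency of the sieved maximum likelihood estimator in the deconvolution problem. -/
theorem mainTheorem4
    {Ω : Type*} [MeasurableSpace Ω] (P : Measure Ω) [IsProbabilityMeasure P]
    (fε : ℝ → ℝ) (hfε : fε ∈ Deconvolution.NoiseClass)
    (hident : Deconvolution.Identifiable fε)
    (FX : ProbabilityMeasure ℝ)
    -- `Y 0, Y 1, …` are i.i.d. with density `fε * dFX`
    (Y : ℕ → Ω → ℝ) (hYmeas : ∀ i, Measurable (Y i)) (hYindep : iIndepFun Y P)
    (hYlaw : ∀ i, P.map (Y i) = Deconvolution.convLaw fε FX)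
    -- the support of `FX` lies in that of the observations, where the sieve puts its mass
    (hsupp : (FX : Measure ℝ).support ⊆ (Deconvolution.convLaw fε FX).support)
    -- almost surely the likelihood does not vanish identically on the sieve for large `n`
    (hlik : ∀ᵐ ω ∂P, ∀ᶠ n : ℕ in atTop,
      ∃ F ∈ Deconvolution.sieve (fun i : Fin n => Y i ω),
        Deconvolution.logLikelihood fε (fun i : Fin n => Y i ω) F ≠ ⊥)
    -- `Fhat n` is any maximum likelihood estimator based on the first `n` observations
    (Fhat : ℕ → Ω → ProbabilityMeasure ℝ)
    (hMLE : ∀ᵐ ω ∂P, ∀ n : ℕ, 1 ≤ n →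
      Deconvolution.IsMLE fε (fun i : Fin n => Y i ω) (Fhat n ω)) :
    (∀ᵐ ω ∂P, ∀ x : ℝ, ContinuousAt (cdf (FX : Measure ℝ)) x →
      Tendsto (fun n : ℕ => cdf (Fhat n ω : Measure ℝ) x) atTop
        (𝓝 (cdf (FX : Measure ℝ) x))) ∧
    (Continuous (cdf (FX : Measure ℝ)) →
      ∀ᵐ ω ∂P, Tendsto
        (fun n : ℕ => ⨆ x : ℝ, |cdf (Fhat n ω : Measure ℝ) x - cdf (FX : Measure ℝ) x|)
        atTop (𝓝 0)) := by
  have hprob : IsProbabilityMeasure (Deconvolution.convLaw fε FX) := by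
    rw [← hYlaw 0]
    exact Measure.isProbabilityMeasure_map (hYmeas 0).aemeasurable
  have hcont : Continuous (cdf (Deconvolution.convLaw fε FX)) := by
    refine continuous_iff_continuousAt.2 fun x => ?_
    rw [Deconvolution.continuousAt_cdf_iff]
    exact withDensity_absolutelyContinuous _ _ (by simp)
  have hweak : ∀ᵐ ω ∂P, ∀ x : ℝ, ContinuousAt (cdf (FX : Measure ℝ)) x →
      Tendsto (fun n : ℕ => cdf (Fhat n ω : Measure ℝ) x) atTop
        (𝓝 (cdf (FX : Measure ℝ) x)) := by
    filter_upwards [hlik, hMLE, Deconvolution.ae_eventually_abs_empiricalMeasure_sub_le hcont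
      hYmeas hYindep hYlaw] with ω h1 h2 h3 x hx
    exact Deconvolution.tendsto_cdf_of_tendsto_toERealMeasure
      (Deconvolution.tendsto_toERealMeasure_of_isMLE hfε hident h3 hsupp h1 h2) hx
  refine ⟨hweak, fun hc => ?_⟩
  filter_upwards [hweak] with ω hω
  exact Deconvolution.tendsto_iSup_abs_cdf_sub hc fun x => hω x hc.continuousAt
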